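/- A digraph on a vertex set $V$ is a pair $G=(V,E)$ with $E\subseteq V\times V$ (loops are allowed). It is a Ferrers digraph if there is a linear order $L$ on $V$ such that $(x,y)\in L$ and $(y,z)\in E$ imply $(x,z)\in E$, for all $x,y,z\in V$. The Ferrers dimension $\operatorname{fd}(G)$ is the smallest number $k\ge 0$ of Ferrers digraphs on $V$ whose intersection is $G$, the intersection of no digraphs being $(V,V\times V)$. There is a polynomial-time $O\!\left(\frac{n\sqrt{\log\log n}}{\sqrt{\log n}}\right)$-factor approximation algorithm for the Ferrers dimension of a digraph on $n$ vertices. That is, there are a function $\rho:\mathbb{N}\to\mathbb{R}$ with $\rho(n)=O\!\left(\frac{n\sqrt{\log\log n}}{\sqrt{\log n}}\right)$ as $n\to\infty$ and an algorithm that, given the adjacency matrix of any digraph $G$ on $n$ vertices, outputs in time polynomial in $n$ a natural number $d$ with $$\operatorname{fd}(G)\le d\le \rho(n)\,\operatorname{fd}(G).$$ -/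

import Mathlib

open Filter Asymptotics

/-! ### Ferrers digraphs and the Ferrers dimension

Digraphs are Mathlib's `Digraph V`: an arbitrary binary relation on `V`, loops allowed. -/

/-- A digraph is a Ferrers digraph if there is a linear order `L` of its vertices such that
`(x, y) ∈ L` and `(y, z) ∈ E` imply `(x, z) ∈ E`. -/
def IsFerrers {V : Type*} (G : Digraph V) : Prop :=
  ∃ L : LinearOrder V, ∀ x y z : V, L.le x y → G.Adj y z → G.Adj x z

/-- `G` is the intersection of `k` Ferrers digraphs on its vertex set.
The intersection of no digraphs is the complete digraph with all loops. -/
def IsFerrersIntersection {V : Type*} (G : Digraph V) (k : ℕ) : Prop :=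
  ∃ F : Fin k → Digraph V, (∀ i, IsFerrers (F i)) ∧ ⨅ i, F i = G

/-- The Ferrers dimension: the smallest number of Ferrers digraphs whose intersection is `G`. -/
noncomputable def ferrersDim {V : Type*} (G : Digraph V) : ℕ :=
  sInf {k | IsFerrersIntersection G k}

/-- On `n` vertices the minimum in `ferrersDim` is over a nonempty set. -/
theorem isFerrersIntersection_card {n : ℕ} (G : Digraph (Fin n)) :
    IsFerrersIntersection G n := by
  classical
  refine ⟨fun i => ⟨fun y z => y = i → G.Adj y z⟩, fun i => ?_, ?_⟩
  · -- order the vertices with `i` as the greatest one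
    let f : Fin n → ℕ ×ₗ Fin n := fun x => toLex (if x = i then 1 else 0, x)
    have hf : Function.Injective f := fun x y h => by
      have h1 := congrArg (fun p => (ofLex p).2) h
      simpa [f] using h1
    refine ⟨LinearOrder.lift' f hf, fun x y z hxy hyz hx => ?_⟩
    have hle : f x ≤ f y := hxy
    rw [Prod.Lex.le_iff] at hle
    subst hx
    by_cases hy : y = x
    · subst hy; exact hyz rfl
    · simp [f, hy] at hle
  · ext y z
    rw [Digraph.iInf_adj]
    exact ⟨fun h => h y rfl, fun h i _ => h⟩

/-! ### The machine model

A random access machine with structured control flow. The memory has registers `0, 1, 2, …` and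
arrays `0, 1, 2, …`, each array with cells `0, 1, 2, …`; registers and cells hold natural numbers.
The only arithmetic is addition and truncated subtraction, so in `t` steps the bit length of the
numbers grows by at most `t + O(1)`, and polynomial time for the unit cost below is polynomial
time on a Turing machine. -/

namespace Ram

/-- The contents of the memory. -/
@[ext] structure Store where
  reg : ℕ → ℕ
  arr : ℕ → ℕ → ℕ

/-- Put the value `v` into register `x`. -/
def Store.setReg (s : Store) (x v : ℕ) : Store :=
  { s with reg := Function.update s.reg x v }

/-- Put the value `v` into cell `i` of array `a`. -/
def Store.setArr (s : Store) (a i v : ℕ) : Store :=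
  { s with arr := Function.update s.arr a (Function.update (s.arr a) i v) }

/-- Programs. The names of the registers and arrays in a program, and its constants, are literals
of the program text; only the index of an array cell is taken from a register. -/
inductive Program where
  /-- do nothing -/
  | skip
  /-- `x := c` -/
  | const (x c : ℕ)
  /-- `x := y + z` -/
  | add (x y z : ℕ)
  /-- `x := max (y - z) 0` -/
  | sub (x y z : ℕ)
  /-- `x := a[i]`, the index being the content of register `i` -/
  | load (x a i : ℕ)
  /-- `a[i] := x`, the index being the content of register `i` -/
  | store (a i x : ℕ)
  /-- first `p`, then `q` -/
  | seq (p q : Program)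
  /-- `p` if register `x` is not zero, else `q` -/
  | ite (x : ℕ) (p q : Program)
  /-- repeat `p` while register `x` is not zero -/
  | while (x : ℕ) (p : Program)

/-- `Run p s t s'`: started on the store `s`, the program `p` halts after exactly `t` steps with
the store `s'`. Every elementary instruction and every test is one step. -/
inductive Run : Program → Store → ℕ → Store → Prop
  | skip (s : Store) : Run .skip s 1 s
  | const (x c : ℕ) (s : Store) : Run (.const x c) s 1 (s.setReg x c)
  | add (x y z : ℕ) (s : Store) : Run (.add x y z) s 1 (s.setReg x (s.reg y + s.reg z))
  | sub (x y z : ℕ) (s : Store) : Run (.sub x y z) s 1 (s.setReg x (s.reg y - s.reg z))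
  | load (x a i : ℕ) (s : Store) : Run (.load x a i) s 1 (s.setReg x (s.arr a (s.reg i)))
  | store (a i x : ℕ) (s : Store) : Run (.store a i x) s 1 (s.setArr a (s.reg i) (s.reg x))
  | seq {p q : Program} {s s' s'' : Store} {t u : ℕ} (hp : Run p s t s') (hq : Run q s' u s'') :
      Run (.seq p q) s (t + u) s''
  | ite_true {x : ℕ} {p q : Program} {s s' : Store} {t : ℕ} (hx : s.reg x ≠ 0)
      (hp : Run p s t s') : Run (.ite x p q) s (t + 1) s'
  | ite_false {x : ℕ} {p q : Program} {s s' : Store} {t : ℕ} (hx : s.reg x = 0)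
      (hq : Run q s t s') : Run (.ite x p q) s (t + 1) s'
  | while_true {x : ℕ} {p : Program} {s s' s'' : Store} {t u : ℕ} (hx : s.reg x ≠ 0)
      (hp : Run p s t s') (hw : Run (.while x p) s' u s'') :
      Run (.while x p) s (t + u + 1) s''
  | while_false {x : ℕ} {p : Program} {s : Store} (hx : s.reg x = 0) :
      Run (.while x p) s 1 s

open Classical in
/-- The input for a digraph `G` on the vertices `0, …, n - 1`: register `0` holds `n`, array `0`
holds the adjacency matrix of `G` row by row, and the rest of the memory is zero. -/
noncomputable def input {n : ℕ} (G : Digraph (Fin n)) : Store where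
  reg x := if x = 0 then n else 0
  arr a k := if a = 0 ∧ ∃ i j : Fin n, k = (i : ℕ) * n + (j : ℕ) ∧ G.Adj i j then 1 else 0

/-- On the input `G` the program `p` halts within `T` steps, with the number `d` in register `1`. -/
def Outputs (p : Program) {n : ℕ} (G : Digraph (Fin n)) (T d : ℕ) : Prop :=
  ∃ (t : ℕ) (s : Store), Run p (input G) t s ∧ t ≤ T ∧ s.reg 1 = d

/-- `p` is a polynomial time algorithm that computes the numerical parameter `f` of digraphs
approximately, within the factor `ρ n` on digraphs with `n` vertices: it outputs a number between
`f G` and `ρ n * f G`. -/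
def IsPolyTimeApprox (p : Program) (f : ∀ {n : ℕ}, Digraph (Fin n) → ℕ) (ρ : ℕ → ℝ) : Prop :=
  ∃ T : Polynomial ℕ, ∀ (n : ℕ) (G : Digraph (Fin n)),
    ∃ d : ℕ, Outputs p G (T.eval n) d ∧ f G ≤ d ∧ (d : ℝ) ≤ ρ n * f G

end Ram

/-! Cut the rows of the adjacency matrix into blocks of `k` rows, and for each block make all rows
outside of it full. Filling rows keeps a digraph Ferrers, so each block digraph has dimension at
most `fd(G)`. The block digraphs intersect in `G`, so their dimensions sum to at least `fd(G)`. The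
sum over the `n / k + 1` blocks is thus an approximation within the factor `n / k + 1`
(`ferrersDim_le_approxDim`, `approxDim_le`).

The dimension of a block is found exactly by exhaustive search (`blockDim_eq_ferrersDim`). It is at
most `k`. By `isFerrers_iff_chain`, a Ferrers digraph orders the rows by inclusion, and a list of
the `k` rows determines the smallest Ferrers digraph that contains the block digraph and respects
that order. Hence `r ≤ k` digraphs amount to at most `k * k` digits in base `k`. Taking `k` maximal
with `k ^ (k * k) ≤ n`, every candidate is coded by some `w ≤ n`. This `k` is at least about `√(log
n / log log n)`, which gives the factor (`approxFactor_isBigO`).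

For the running time, `Polytime` is shown to be closed under arithmetic, bounded sums, bounded
quantifiers and bounded recursion; the algorithm is an expression built from these. -/

/-! ### Functions computable in polynomial time -/

namespace Ram

/-- A context interprets variables `0, 1, 2, …` and a read-only array of bits; polynomial bounds
are relative to its size. -/
class Context (α : Type*) where
  var : α → ℕ → ℕ
  cell : α → ℕ → ℕ
  size : α → ℕ
  var_le : ∀ a i, var a i ≤ size a
  cell_le : ∀ a i, cell a i ≤ 1

open Context

/-- The extension of a context by a new variable `0`. -/
instance {α : Type*} [Context α] : Context (α × ℕ) where
  var x i := Nat.casesOn i x.2 (fun j => var x.1 j)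
  cell x := cell x.1
  size x := size x.1 + x.2
  var_le x i := by
    cases i with
    | zero => exact Nat.le_add_left _ _
    | succ j => exact (var_le x.1 j).trans (Nat.le_add_right _ _)
  cell_le x i := cell_le x.1 i

variable {α : Type*} [Context α]

/-- `f` is bounded by a polynomial in the size of the context. -/
def PolyBounded (f : α → ℕ) : Prop :=
  ∃ e : ℕ, ∀ a, f a ≤ (size a + 2) ^ e

namespace PolyBounded

theorem mono {f g : α → ℕ} (hg : PolyBounded g) (h : ∀ a, f a ≤ g a) : PolyBounded f := by
  obtain ⟨e, he⟩ := hg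
  exact ⟨e, fun a => (h a).trans (he a)⟩

theorem size : PolyBounded (fun a : α => Context.size a) :=
  ⟨1, fun a => by simp⟩

theorem const (c : ℕ) : PolyBounded (fun _ : α => c) :=
  ⟨c, fun a => (Nat.lt_pow_self (by omega)).le⟩

theorem mul {f g : α → ℕ} (hf : PolyBounded f) (hg : PolyBounded g) :
    PolyBounded (fun a => f a * g a) := by
  obtain ⟨d, hd⟩ := hf
  obtain ⟨e, he⟩ := hg
  exact ⟨d + e, fun a => by rw [pow_add]; exact Nat.mul_le_mul (hd a) (he a)⟩

theorem add {f g : α → ℕ} (hf : PolyBounded f) (hg : PolyBounded g) :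
    PolyBounded (fun a => f a + g a) := by
  obtain ⟨d, hd⟩ := hf
  obtain ⟨e, he⟩ := hg
  refine ⟨d + e + 1, fun a => ?_⟩
  have h2 : (Context.size a + 2) ^ d ≤ (Context.size a + 2) ^ (d + e) :=
    Nat.pow_le_pow_right (by omega) (by omega)
  have h3 : (Context.size a + 2) ^ e ≤ (Context.size a + 2) ^ (d + e) :=
    Nat.pow_le_pow_right (by omega) (by omega)
  have h4 : (Context.size a + 2) ^ (d + e) * 2 ≤ (Context.size a + 2) ^ (d + e + 1) := by
    rw [pow_succ]; exact Nat.mul_le_mul_left _ (by omega)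
  exact ((Nat.add_le_add ((hd a).trans h2) ((he a).trans h3)).trans_eq (mul_two _).symm).trans h4

theorem pow {f : α → ℕ} (hf : PolyBounded f) (e : ℕ) : PolyBounded (fun a => f a ^ e) := by
  induction e with
  | zero => simpa using const 1
  | succ e ih => simpa only [pow_succ] using ih.mul hf

theorem comp_fst {f : α → ℕ} (hf : PolyBounded f) : PolyBounded (fun x : α × ℕ => f x.1) := by
  obtain ⟨e, he⟩ := hf
  exact ⟨e, fun x => (he x.1).trans (Nat.pow_le_pow_left
    (Nat.add_le_add_right (Nat.le_add_right _ _) _) _)⟩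

/-- A polynomially bounded function of a context with one more variable has a polynomial bound
that is uniform over the values of the variable up to a polynomial bound. -/
theorem exists_uniform {g : α × ℕ → ℕ} {f : α → ℕ} (hg : PolyBounded g) (hf : PolyBounded f) :
    ∃ h : α → ℕ, PolyBounded h ∧ ∀ a i, i ≤ f a → g (a, i) ≤ h a := by
  obtain ⟨e, he⟩ := hg
  refine ⟨_, ((size.add hf).add (const 2)).pow e, fun a i hi => (he (a, i)).trans ?_⟩
  exact Nat.pow_le_pow_left (Nat.add_le_add_right (Nat.add_le_add_left hi _) _) _

end PolyBounded

/-- `f` is computed in polynomial time by a program that can be placed above any number `M` of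
registers, for every placement `ι` of the variables below `M`. It leaves the result in
register `M`. -/
def Polytime (f : α → ℕ) : Prop :=
  PolyBounded f ∧ ∃ T : α → ℕ, PolyBounded T ∧
    ∀ (M : ℕ) (ι : ℕ → ℕ), (∀ i, ι i < M) → ∃ p : Program, ∀ (s : Store) (a : α),
      (∀ i, s.reg (ι i) = var a i) → s.arr 0 = cell a →
        ∃ (t : ℕ) (s' : Store), Run p s t s' ∧ t ≤ T a ∧
          (∀ i < M, s'.reg i = s.reg i) ∧ s'.arr = s.arr ∧ s'.reg M = f a

namespace Polytime

theorem const (c : ℕ) : Polytime (fun _ : α => c) := by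
  refine ⟨.const c, fun _ => 1, .const 1, fun M ι hι => ⟨.const M c, fun s a _ _ =>
    ⟨_, _, .const _ _ _, le_rfl, fun i hi => ?_, rfl, ?_⟩⟩⟩
  · simp [Store.setReg, hi.ne]
  · simp [Store.setReg]

theorem var (i : ℕ) : Polytime (fun a : α => Context.var a i) := by
  refine ⟨PolyBounded.size.mono fun a => var_le a i, fun _ => 1 + 1, .const _, fun M ι hι =>
    -- A register is copied by adding it to zero.
    ⟨.seq (.const M 0) (.add M M (ι i)), fun s a hs _ =>
    ⟨_, _, .seq (.const _ _ _) (.add _ _ _ _), le_rfl, fun j hj => ?_, rfl, ?_⟩⟩⟩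
  · simp [Store.setReg, hj.ne]
  · simp [Store.setReg, (hι i).ne, hs]

theorem snd : Polytime (fun x : α × ℕ => x.2) := var 0

theorem comp_fst {f : α → ℕ} (hf : Polytime f) : Polytime (fun x : α × ℕ => f x.1) := by
  obtain ⟨hb, T, hT, h⟩ := hf
  refine ⟨hb.comp_fst, _, hT.comp_fst, fun M ι hι => ?_⟩
  obtain ⟨p, hp⟩ := h M (fun i => ι (i + 1)) (fun i => hι _)
  exact ⟨p, fun s a hs hc => hp s a.1 (fun i => hs (i + 1)) hc⟩

theorem fst_snd : Polytime (fun x : (α × ℕ) × ℕ => x.1.2) := snd.comp_fst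

theorem cell {f : α → ℕ} (hf : Polytime f) : Polytime (fun a => Context.cell a (f a)) := by
  obtain ⟨hb, T, hT, h⟩ := hf
  refine ⟨(PolyBounded.const 1).mono fun a => cell_le a _, _, hT.add (.const 1), fun M ι hι => ?_⟩
  obtain ⟨p, hp⟩ := h M ι hι
  refine ⟨.seq p (.load M 0 M), fun s a hs hc => ?_⟩
  obtain ⟨t, s', hr, ht, hM, harr, hf⟩ := hp s a hs hc
  refine ⟨_, _, .seq hr (.load _ _ _ _), by omega, fun i hi => ?_, harr, ?_⟩
  · simp [Store.setReg, hi.ne, hM i hi]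
  · simp [Store.setReg, harr, hc, hf]

/-- Compute `f` and `g`, then combine the results by one instruction. -/
theorem binary {f g : α → ℕ} (op : ℕ → ℕ → ℕ) (instr : ℕ → ℕ → ℕ → Program)
    (hinstr : ∀ x y z s, Run (instr x y z) s 1 (s.setReg x (op (s.reg y) (s.reg z))))
    (hop : ∀ x y, op x y ≤ x + y) (hf : Polytime f) (hg : Polytime g) :
    Polytime (fun a => op (f a) (g a)) := by
  obtain ⟨hbf, T, hT, hf⟩ := hf
  obtain ⟨hbg, U, hU, hg⟩ := hg
  refine ⟨(hbf.add hbg).mono fun a => hop _ _, _, hT.add (hU.add (.const 1)), fun M ι hι => ?_⟩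
  obtain ⟨p, hp⟩ := hf M ι hι
  obtain ⟨q, hq⟩ := hg (M + 1) ι fun i => (hι i).trans M.lt_succ_self
  refine ⟨.seq p (.seq q (instr M M (M + 1))), fun s a hs hc => ?_⟩
  obtain ⟨t, s', hr, ht, hM, harr, hf⟩ := hp s a hs hc
  obtain ⟨t', s'', hr', ht', hM', harr', hg⟩ := hq s' a
    (fun i => by rw [hM _ (hι i), hs]) (by rw [harr, hc])
  refine ⟨_, _, .seq hr (.seq hr' (hinstr _ _ _ _)), by omega, fun i hi => ?_,
    harr'.trans harr, ?_⟩
  · simp [Store.setReg, hi.ne, hM i hi, hM' i (by omega)]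
  · simp [Store.setReg, hM' M (by omega), hf, hg]

theorem add {f g : α → ℕ} (hf : Polytime f) (hg : Polytime g) : Polytime (fun a => f a + g a) :=
  binary _ _ Run.add (fun _ _ => le_rfl) hf hg

theorem sub {f g : α → ℕ} (hf : Polytime f) (hg : Polytime g) : Polytime (fun a => f a - g a) :=
  binary _ _ Run.sub (fun _ _ => by omega) hf hg

/-- Primitive recursion with polynomially bounded values. -/
theorem recursion {f z b : α → ℕ} {g : (α × ℕ) × ℕ → ℕ} (R : α → ℕ → ℕ) (hf : Polytime f)
    (hz : Polytime z) (hg : Polytime g) (hb : PolyBounded b) (h0 : ∀ a, R a 0 = z a)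
    (hR : ∀ a i, R a (i + 1) = g ((a, i), R a i)) (hRb : ∀ a i, i ≤ f a → R a i ≤ b a) :
    Polytime (fun a => R a (f a)) := by
  obtain ⟨hbf, T, hT, hf⟩ := hf
  obtain ⟨-, U, hU, hz⟩ := hz
  obtain ⟨-, W, hW, hg⟩ := hg
  obtain ⟨V, hV, hWV⟩ := hW.exists_uniform hb.comp_fst
  obtain ⟨B, hB, hVB⟩ := hV.exists_uniform hbf
  have hWB : ∀ a i, i ≤ f a → W ((a, i), R a i) ≤ B a := fun a i hi =>
    (hWV _ _ (hRb a i hi)).trans (hVB _ _ hi)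
  refine ⟨hb.mono fun a => hRb a _ le_rfl, _,
    -- Each round costs five instructions and one test besides `r`. The 4 covers the initialisation
    -- of the index, the last test and the final copy.
    (hT.add (hU.add (hbf.mul (hB.add (.const 6))))).add (.const 4), fun M ι hι => ?_⟩
  obtain ⟨p, hp⟩ := hf M ι hι
  obtain ⟨q, hq⟩ := hz (M + 2) ι fun i => (hι i).trans (by omega)
  obtain ⟨r, hr⟩ := hg (M + 3)
    (fun i => Nat.casesOn i (M + 2) fun j => Nat.casesOn j (M + 1) ι) (by
      rintro (_ | _ | i)
      · exact Nat.lt_succ_self _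
      · exact Nat.lt_succ_of_lt (Nat.lt_succ_self _)
      · exact (hι i).trans (by omega))
  -- Register `M` counts the remaining rounds, `M + 1` holds the index `i`, `M + 2` holds `R a i`,
  -- and `M + 4` is scratch.
  let body : Program := .seq r (.seq (.const (M + 4) 0) (.seq (.add (M + 2) (M + 3) (M + 4))
    (.seq (.const (M + 4) 1) (.seq (.add (M + 1) (M + 1) (M + 4)) (.sub M M (M + 4))))))
  have loop : ∀ (c : ℕ) (s : Store) (a : α) (i : ℕ), (∀ i, s.reg (ι i) = Context.var a i) →
      s.arr 0 = Context.cell a → c + i = f a → s.reg M = c → s.reg (M + 1) = i →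
      s.reg (M + 2) = R a i → ∃ (t : ℕ) (s' : Store), Run (.while M body) s t s' ∧
        t ≤ c * (B a + 6) + 1 ∧ (∀ i < M, s'.reg i = s.reg i) ∧ s'.arr = s.arr ∧
        s'.reg (M + 2) = R a (f a) := by
    intro c
    induction c with
    | zero =>
      intro s a i _ _ hi hM _ hM2
      refine ⟨_, _, .while_false hM, by omega, fun _ _ => rfl, rfl, ?_⟩
      rw [hM2, ← hi, Nat.zero_add]
    | succ c ih =>
      intro s a i hs hc hi hM hM1 hM2
      obtain ⟨t, s', hrun, ht, hreg, harr, hval⟩ := hr s ((a, i), R a i) (by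
        rintro (_ | _ | j)
        · exact hM2
        · exact hM1
        · exact hs j) hc
      have hrun' := hrun.seq (.seq (.const (M + 4) 0 _) (.seq (.add (M + 2) (M + 3) (M + 4) _)
        (.seq (.const (M + 4) 1 _) (.seq (.add (M + 1) (M + 1) (M + 4) _) (.sub M M (M + 4) _)))))
      generalize hs'' : Store.setReg _ M _ = s'' at hrun'
      have hlow : ∀ i < M, s''.reg i = s.reg i := fun i hi => by
        rw [← hreg i (by omega), ← hs'']
        simp (disch := omega) [Store.setReg, Function.update_of_ne]
      obtain ⟨t', s3, hrun3, ht', hreg3, harr3, hval3⟩ := ih s'' a (i + 1)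
        (fun j => by rw [hlow _ (hι j), hs]) (by rw [← hs'', ← hc, ← harr]; rfl) (by omega)
        (by rw [← hs'']; simp [Store.setReg, hreg M, hM])
        (by rw [← hs'']; simp [Store.setReg, hreg (M + 1), hM1])
        (by rw [← hs'']; simp [Store.setReg, hval, hR])
      refine ⟨_, _, .while_true (by omega) hrun' hrun3, ?_,
        fun i hi => (hreg3 i hi).trans (hlow i hi), ?_, hval3⟩
      · have := hWB a i (by omega)
        rw [Nat.succ_mul]
        omega
      · rw [harr3, ← harr, ← hs'']; rfl
  refine ⟨.seq p (.seq (.const (M + 1) 0) (.seq q (.seq (.while M body)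
    (.seq (.const (M + 3) 0) (.add M (M + 2) (M + 3)))))), fun s a hs hc => ?_⟩
  obtain ⟨t, s1, hr1, ht1, hreg1, harr1, hval1⟩ := hp s a hs hc
  obtain ⟨u, s2, hr2, ht2, hreg2, harr2, hval2⟩ := hq (s1.setReg (M + 1) 0) a
    (fun i => by
      have := hι i
      simp (disch := omega) [Store.setReg, Function.update_of_ne, hreg1, hs])
    (by rw [← hc, ← harr1]; rfl)
  have hlow : ∀ i < M, s2.reg i = s.reg i := fun i hi => by
    rw [hreg2 i (by omega), ← hreg1 i hi]
    simp (disch := omega) [Store.setReg, Function.update_of_ne]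
  obtain ⟨v, s3, hr3, ht3, hreg3, harr3, hval3⟩ := loop (f a) s2 a 0
    (fun i => by rw [hlow _ (hι i), hs]) (by rw [harr2, ← hc, ← harr1]; rfl) rfl
    (by rw [hreg2 M (by omega)]; simp [Store.setReg, hval1])
    (by rw [hreg2 (M + 1) (by omega)]; simp [Store.setReg]) (by rw [hval2, h0])
  refine ⟨_, _, hr1.seq (.seq (.const _ _ _) (hr2.seq (hr3.seq (.seq (.const _ _ _)
    (.add _ _ _ _))))), by omega, fun i hi => ?_, ?_, ?_⟩
  · rw [← hlow i hi, ← hreg3 i hi]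
    simp (disch := omega) [Store.setReg, Function.update_of_ne]
  · exact harr3.trans (harr2.trans harr1)
  · simp [Store.setReg, hval3]

theorem sum {f : α → ℕ} {g : α → ℕ → ℕ} (hf : Polytime f)
    (hg : Polytime (fun x : α × ℕ => g x.1 x.2)) :
    Polytime (fun a => ∑ i ∈ Finset.range (f a), g a i) := by
  obtain ⟨b, hb, hgb⟩ := hg.1.exists_uniform hf.1
  refine recursion (fun a m => ∑ i ∈ Finset.range m, g a i) hf (const 0)
    (snd.add hg.comp_fst) (hf.1.mul hb) (fun a => rfl)
    (fun a i => Finset.sum_range_succ _ _) fun a i hi => ?_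
  calc ∑ j ∈ Finset.range i, g a j ≤ ∑ _j ∈ Finset.range i, b a :=
        Finset.sum_le_sum fun j hj => hgb a j (by have := Finset.mem_range.1 hj; omega)
    _ = i * b a := by simp
    _ ≤ f a * b a := Nat.mul_le_mul_right _ hi

/-- Multiplication is not an instruction; a product is a sum of equal terms. -/
theorem mul {f g : α → ℕ} (hf : Polytime f) (hg : Polytime g) : Polytime (fun a => f a * g a) := by
  simpa using sum (g := fun a _ => g a) hf hg.comp_fst

end Polytime

/-! ### Predicates decidable in polynomial time, bounded search and division -/

open Classical in
/-- The predicate `P` is decided in polynomial time. -/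
def PolytimePred (P : α → Prop) : Prop :=
  Polytime (fun a => if P a then 1 else 0)

namespace PolytimePred

theorem of_iff {P Q : α → Prop} (hP : PolytimePred P) (h : ∀ a, Q a ↔ P a) : PolytimePred Q := by
  rwa [show Q = P from funext fun a => propext (h a)]

theorem indicator {P : α → Prop} [DecidablePred P] (hP : PolytimePred P) :
    Polytime (fun a => if P a then 1 else 0) := by
  unfold PolytimePred at hP
  convert hP

theorem not {P : α → Prop} (hP : PolytimePred P) : PolytimePred (fun a => ¬ P a) := by
  classical
  have h := (Polytime.const 1).sub hP
  unfold PolytimePred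
  convert h using 2 with a
  by_cases hP : P a <;> simp [hP]

theorem and {P Q : α → Prop} (hP : PolytimePred P) (hQ : PolytimePred Q) :
    PolytimePred (fun a => P a ∧ Q a) := by
  classical
  have h := Polytime.mul hP hQ
  unfold PolytimePred
  convert h using 2 with a
  by_cases hP : P a <;> by_cases hQ : Q a <;> simp [hP, hQ]

theorem imp {P Q : α → Prop} (hP : PolytimePred P) (hQ : PolytimePred Q) :
    PolytimePred (fun a => P a → Q a) :=
  (hP.and hQ.not).not.of_iff fun a => by tauto

theorem eq_zero {f : α → ℕ} (hf : Polytime f) : PolytimePred (fun a => f a = 0) := by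
  have h := (Polytime.const 1).sub hf
  unfold PolytimePred
  convert h using 2 with a
  split_ifs <;> omega

theorem le {f g : α → ℕ} (hf : Polytime f) (hg : Polytime g) :
    PolytimePred (fun a => f a ≤ g a) :=
  (eq_zero (hf.sub hg)).of_iff fun _ => Nat.sub_eq_zero_iff_le.symm

theorem lt {f g : α → ℕ} (hf : Polytime f) (hg : Polytime g) :
    PolytimePred (fun a => f a < g a) :=
  (le hg hf).not.of_iff fun _ => not_le.symm

theorem eq {f g : α → ℕ} (hf : Polytime f) (hg : Polytime g) :
    PolytimePred (fun a => f a = g a) :=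
  ((le hf hg).and (le hg hf)).of_iff fun _ => le_antisymm_iff

theorem forall_lt {f : α → ℕ} {P : α → ℕ → Prop} (hf : Polytime f)
    (hP : PolytimePred (fun x : α × ℕ => P x.1 x.2)) :
    PolytimePred (fun a => ∀ i < f a, P a i) := by
  classical
  exact (eq_zero (Polytime.sum (g := fun a i => if ¬ P a i then 1 else 0) hf
    hP.not.indicator)).of_iff fun a => by simp

theorem exists_lt {f : α → ℕ} {P : α → ℕ → Prop} (hf : Polytime f)
    (hP : PolytimePred (fun x : α × ℕ => P x.1 x.2)) :
    PolytimePred (fun a => ∃ i < f a, P a i) :=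
  (forall_lt (P := fun a i => ¬ P a i) hf hP.not).not.of_iff fun a => by push Not; rfl

end PolytimePred

namespace Polytime

theorem ite {P : α → Prop} [DecidablePred P] {f g : α → ℕ} (hP : PolytimePred P)
    (hf : Polytime f) (hg : Polytime g) : Polytime (fun a => if P a then f a else g a) := by
  classical
  have h := (mul hP hf).add (mul hP.not hg)
  convert h using 2 with a
  by_cases hP : P a <;> simp [hP]

theorem findGreatest {f : α → ℕ} {P : α → ℕ → Prop} [∀ a, DecidablePred (P a)] (hf : Polytime f)
    (hP : PolytimePred (fun x : α × ℕ => P x.1 (x.2 + 1))) :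
    Polytime (fun a => Nat.findGreatest (P a) (f a)) :=
  recursion (fun a m => Nat.findGreatest (P a) m) hf (const 0)
    (ite hP.comp_fst (fst_snd.add (const 1)) snd) hf.1 (fun _ => rfl)
    (fun _ i => Nat.findGreatest_succ i) fun _ i hi => (Nat.findGreatest_le i).trans hi

theorem div {f g : α → ℕ} (hf : Polytime f) (hg : Polytime g) : Polytime (fun a => f a / g a) := by
  -- The condition `0 < g a` makes the search return its default 0 for a zero divisor, as `Nat`
  -- division does.
  have h := findGreatest (P := fun a q => 0 < g a ∧ q * g a ≤ f a) hf
    ((PolytimePred.lt (const 0) hg.comp_fst).and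
      (.le ((snd.add (const 1)).mul hg.comp_fst) hf.comp_fst))
  convert h using 2 with a
  symm
  rw [Nat.findGreatest_eq_iff]
  refine ⟨Nat.div_le_self _ _, fun h => ⟨Nat.pos_of_ne_zero fun h0 => h (by simp [h0]),
    Nat.div_mul_le_self _ _⟩, fun q hq _ ⟨h0, hle⟩ => ?_⟩
  exact absurd ((Nat.le_div_iff_mul_le h0).2 hle) (by omega)

theorem mod {f g : α → ℕ} (hf : Polytime f) (hg : Polytime g) : Polytime (fun a => f a % g a) := by
  simpa only [Nat.mod_eq_sub] using hf.sub (hg.mul (hf.div hg))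

/-- The power itself may be too large to compute in polynomial time. Dividing `h a` times by `g a`
keeps all intermediate values at most `f a`. -/
theorem div_pow {f g h : α → ℕ} (hf : Polytime f) (hg : Polytime g) (hh : Polytime h) :
    Polytime (fun a => f a / g a ^ h a) :=
  recursion (fun a m => f a / g a ^ m) hh hf (snd.div hg.comp_fst.comp_fst) hf.1
    (fun a => by simp) (fun a i => by rw [pow_succ, Nat.div_div_eq_div_mul])
    fun a i _ => Nat.div_le_self _ _

end Polytime

end Ram

/-! ### Ferrers dimension and blocks of vertices -/

/-- A digraph on finitely many vertices is Ferrers if its sets of out-neighbours form a chain. -/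
theorem isFerrers_iff_chain {n : ℕ} (G : Digraph (Fin n)) :
    IsFerrers G ↔ ∀ x y, (∀ z, G.Adj x z → G.Adj y z) ∨ (∀ z, G.Adj y z → G.Adj x z) := by
  classical
  constructor
  · rintro ⟨L, hL⟩ x y
    rcases L.le_total x y with h | h
    · exact .inr fun z => hL x y z h
    · exact .inl fun z => hL y x z h
  · intro h
    let N : Fin n → Finset (Fin n) := fun x => {z | G.Adj x z}
    -- Vertices with more out-neighbours come first; the second component breaks ties.
    let f : Fin n → ℕ ×ₗ Fin n := fun x => toLex (n - (N x).card, x)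
    have hf : Function.Injective f := fun x y h => by
      have h1 := congrArg (fun p => (ofLex p).2) h
      simpa [f] using h1
    refine ⟨LinearOrder.lift' f hf, fun x y z hxy hyz => ?_⟩
    have hle : f x ≤ f y := hxy
    have hle' : n - (N x).card ≤ n - (N y).card := Prod.Lex.monotone_fst _ _ hle
    have hx : (N x).card ≤ n := by simpa using Finset.card_le_univ (N x)
    have hy : (N y).card ≤ n := by simpa using Finset.card_le_univ (N y)
    rcases h x y with h | h
    · have : N x = N y := Finset.eq_of_subset_of_card_le
        (fun z hz => by simpa [N] using h z (by simpa [N] using hz)) (by omega)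
      have hz : z ∈ N x := by rw [this]; simpa [N] using hyz
      simpa [N] using hz
    · exact h z hyz

theorem isFerrersIntersection_iff {n : ℕ} (G : Digraph (Fin n)) (r : ℕ) :
    IsFerrersIntersection G r ↔ ∃ F : Fin r → Digraph (Fin n), (∀ i, IsFerrers (F i)) ∧
      ∀ x y, G.Adj x y ↔ ∀ i, (F i).Adj x y := by
  refine exists_congr fun F => and_congr_right fun _ => ?_
  constructor
  · rintro rfl x y
    exact Digraph.iInf_adj
  · intro h
    ext x y
    rw [Digraph.iInf_adj, h]

theorem IsFerrersIntersection.inf {n r r' : ℕ} {G G' : Digraph (Fin n)}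
    (h : IsFerrersIntersection G r) (h' : IsFerrersIntersection G' r') :
    IsFerrersIntersection (G ⊓ G') (r + r') := by
  rw [isFerrersIntersection_iff] at *
  obtain ⟨F, hF, hG⟩ := h
  obtain ⟨F', hF', hG'⟩ := h'
  refine ⟨Fin.append F F', fun i => ?_, fun x y => ?_⟩
  · refine Fin.addCases (fun i => ?_) (fun i => ?_) i
    · simpa using hF i
    · simpa using hF' i
  · rw [Digraph.inf_adj, hG, hG']
    constructor
    · rintro ⟨h, h'⟩ i
      refine Fin.addCases (fun i => ?_) (fun i => ?_) i
      · simpa using h i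
      · simpa using h' i
    · intro h
      exact ⟨fun i => by simpa using h (Fin.castAdd _ i), fun i => by simpa using h (Fin.natAdd _ i)⟩

theorem isFerrersIntersection_top {n : ℕ} (r : ℕ) :
    IsFerrersIntersection (⊤ : Digraph (Fin n)) r := by
  rw [isFerrersIntersection_iff]
  exact ⟨fun _ => ⊤, fun i => (isFerrers_iff_chain _).2 fun x y => .inl fun z _ => trivial,
    fun x y => iff_of_true trivial fun _ => trivial⟩

theorem IsFerrersIntersection.mono {n r r' : ℕ} {G : Digraph (Fin n)}
    (h : IsFerrersIntersection G r) (hr : r ≤ r') : IsFerrersIntersection G r' := by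
  obtain ⟨m, rfl⟩ := Nat.exists_eq_add_of_le hr
  simpa using h.inf (isFerrersIntersection_top m)

theorem isFerrersIntersection_ferrersDim {n : ℕ} (G : Digraph (Fin n)) :
    IsFerrersIntersection G (ferrersDim G) :=
  Nat.sInf_mem (s := {k | IsFerrersIntersection G k}) ⟨n, isFerrersIntersection_card G⟩

theorem ferrersDim_le_iff {n : ℕ} (G : Digraph (Fin n)) (r : ℕ) :
    ferrersDim G ≤ r ↔ IsFerrersIntersection G r :=
  ⟨(isFerrersIntersection_ferrersDim G).mono, fun h => Nat.sInf_le h⟩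

/-- Add all arcs that start outside of the set `S`. -/
def Digraph.fillOutside {n : ℕ} (G : Digraph (Fin n)) (S : Set ℕ) : Digraph (Fin n) where
  Adj x y := (x : ℕ) ∈ S → G.Adj x y

/-- Filling a row puts it at the top of the chain of out-neighbourhoods, so each factor stays
Ferrers, and filling commutes with intersections. -/
theorem IsFerrersIntersection.fillOutside {n r : ℕ} {G : Digraph (Fin n)} (S : Set ℕ)
    (h : IsFerrersIntersection G r) : IsFerrersIntersection (G.fillOutside S) r := by
  rw [isFerrersIntersection_iff] at *
  obtain ⟨F, hF, hG⟩ := h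
  refine ⟨fun i => (F i).fillOutside S, fun i => ?_, fun x y => ?_⟩
  · rw [isFerrers_iff_chain]
    intro x y
    by_cases hx : (x : ℕ) ∈ S
    · by_cases hy : (y : ℕ) ∈ S
      · simpa [Digraph.fillOutside, hx, hy] using (isFerrers_iff_chain _).1 (hF i) x y
      · exact .inl fun z _ h => absurd h hy
    · exact .inr fun z _ h => absurd h hx
  · simp only [Digraph.fillOutside, hG]
    exact forall_comm

/-- The interval of the vertices of the block number `b`, for blocks of `k` vertices. -/
def vertexBlock (k b : ℕ) : Set ℕ := {x | b * k ≤ x ∧ x < b * k + k}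

theorem ferrersDim_fillOutside_le {n : ℕ} (G : Digraph (Fin n)) (S : Set ℕ) :
    ferrersDim (G.fillOutside S) ≤ ferrersDim G :=
  (ferrersDim_le_iff _ _).2 ((isFerrersIntersection_ferrersDim G).fillOutside S)

/-- The blocks cover all vertices, so `G` is the intersection of its block digraphs, and
representations of these can be concatenated. -/
theorem ferrersDim_le_sum_blocks {n k m : ℕ} (G : Digraph (Fin n)) (h : n ≤ m * k) :
    ferrersDim G ≤ ∑ b ∈ Finset.range m, ferrersDim (G.fillOutside (vertexBlock k b)) := by
  have key : ∀ m : ℕ, IsFerrersIntersection (G.fillOutside {x | x < m * k})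
      (∑ b ∈ Finset.range m, ferrersDim (G.fillOutside (vertexBlock k b))) := by
    intro m
    induction m with
    | zero =>
      have : G.fillOutside {x | x < 0 * k} = ⊤ := by
        ext x y
        simp [Digraph.fillOutside]
      rw [this]
      exact isFerrersIntersection_top _
    | succ m ih =>
      rw [Finset.sum_range_succ]
      convert ih.inf (isFerrersIntersection_ferrersDim (G.fillOutside (vertexBlock k m))) using 1
      ext x y
      simp only [Digraph.fillOutside, Digraph.inf_adj, vertexBlock, Set.mem_ofPred_eq, Nat.succ_mul]
      by_cases hx : (x : ℕ) < m * k
      · simp [hx, hx.trans_le (Nat.le_add_right _ k), hx.not_ge]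
      · simp [hx, not_lt.1 hx]
  rw [ferrersDim_le_iff]
  convert key m using 1
  ext x y
  simp [Digraph.fillOutside, x.2.trans_le h]

/-! ### The exact dimension of a block by exhaustive search -/

/-- `A`, read as an adjacency matrix with `n` columns, has a zero in row `x < n` and
column `y`. -/
def IsZeroEntry (A : ℕ → ℕ) (n x y : ℕ) : Prop :=
  x < n ∧ A (x * n + y) = 0

/-- The digit number `m` of `w` in base `k`. -/
def baseDigit (k w m : ℕ) : ℕ := w / k ^ m % k

/-- The digits `i * k, …, i * k + k - 1` of `w` list rows of block `b`. A row is excluded from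
column `y` if the list, up to an occurrence of the row, names only zero entries of the column. -/
def ExcludesRow (A : ℕ → ℕ) (n k b w i j y : ℕ) : Prop :=
  ∃ l < k, baseDigit k w (i * k + l) = j ∧
    ∀ l' < l + 1, IsZeroEntry A n (b * k + baseDigit k w (i * k + l')) y

/-- Some `w ≤ n` encodes `r` lists that together exclude all zero entries of block `b`. -/
def BlockTest (A : ℕ → ℕ) (n k b r : ℕ) : Prop :=
  ∃ w < n + 1, ∀ y < n, ∀ j < k, IsZeroEntry A n (b * k + j) y →
    ∃ i < r, ExcludesRow A n k b w i j y

/-- The non-arcs of the `i`-th digraph are the pairs excluded by list `i`. Of two rows in a list,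
the earlier is excluded from every column that excludes the later, so out-neighbourhoods form a
chain. Lists with repetitions do no harm. -/
theorem BlockTest.isFerrersIntersection {n k b r : ℕ} {A : ℕ → ℕ} {G : Digraph (Fin n)}
    (hA : ∀ x y : Fin n, A (x * n + y) = 0 ↔ ¬ G.Adj x y) (h : BlockTest A n k b r) :
    IsFerrersIntersection (G.fillOutside (vertexBlock k b)) r := by
  obtain ⟨w, -, hw⟩ := h
  rw [isFerrersIntersection_iff]
  refine ⟨fun i => ⟨fun x y => ¬ ∃ j, (x : ℕ) = b * k + j ∧ ExcludesRow A n k b w i j y⟩,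
    fun i => ?_, fun x y => ?_⟩
  · rw [isFerrers_iff_chain]
    intro x y
    by_contra hcon
    simp only [not_or, not_forall] at hcon
    obtain ⟨⟨z, hxz, hyz⟩, z', hyz', hxz'⟩ := hcon
    obtain ⟨j, hj, l, hl, hd, hp⟩ := not_not.1 hyz
    obtain ⟨j', hj', l', hl', hd', hp'⟩ := not_not.1 hxz'
    rcases le_total l l' with hll | hll
    · exact hyz' ⟨j, hj, l, hl, hd, fun m hm => hp' m (by omega)⟩
    · exact hxz ⟨j', hj', l', hl', hd', fun m hm => hp m (by omega)⟩
  · constructor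
    · rintro hG i ⟨j, hj, l, hl, hd, hp⟩
      have hz := (hp l (by omega)).2
      rw [hd, ← hj, hA] at hz
      have hjk : j < k := hd ▸ Nat.mod_lt _ (by omega)
      exact hz (hG ⟨by omega, by omega⟩)
    · rintro hF ⟨hx1, hx2⟩
      by_contra hG
      obtain ⟨j, hj⟩ := Nat.exists_eq_add_of_le hx1
      obtain ⟨i, hi, hex⟩ := hw y y.2 j (by omega) ⟨by omega, by rw [← hj, hA]; exact hG⟩
      exact hF ⟨i, hi⟩ ⟨j, hj, hex⟩

/-- Finitely many nested subsets can be listed in decreasing order. -/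
theorem exists_perm_antitone_of_chain {n k : ℕ} (T : Fin k → Finset (Fin n))
    (hT : ∀ i j, T i ⊆ T j ∨ T j ⊆ T i) :
    ∃ σ : Equiv.Perm (Fin k), ∀ l l', l ≤ l' → T (σ l') ⊆ T (σ l) := by
  let f : Fin k → ℕ := fun j => n - (T j).card
  refine ⟨Tuple.sort f, fun l l' hl => ?_⟩
  have h : n - (T (Tuple.sort f l)).card ≤ n - (T (Tuple.sort f l')).card :=
    Tuple.monotone_sort f hl
  have h1 : (T (Tuple.sort f l)).card ≤ n := by simpa using Finset.card_le_univ (T (Tuple.sort f l))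
  have h2 : (T (Tuple.sort f l')).card ≤ n := by
    simpa using Finset.card_le_univ (T (Tuple.sort f l'))
  rcases hT (Tuple.sort f l') (Tuple.sort f l) with h3 | h3
  · exact h3
  · exact (Finset.eq_of_subset_of_card_le h3 (by omega)).ge

theorem exists_baseDigit_eq {k m : ℕ} (σ : Fin m → Fin k) :
    ∃ w < k ^ m, ∀ i : Fin m, baseDigit k w i = σ i := by
  refine ⟨finFunctionFinEquiv σ, (finFunctionFinEquiv σ).2, fun i => ?_⟩
  have h := finFunctionFinEquiv_symm_apply_val (finFunctionFinEquiv σ) i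
  rw [Equiv.symm_apply_apply] at h
  exact h.symm

/-- List the rows of the block by decreasing set of non-arcs in the `i`-th factor. If this factor
lacks the arc from a row to `y`, it also lacks those from all earlier rows, so `G` has zeros there
and the row is excluded. -/
theorem IsFerrersIntersection.blockTest {n k b r : ℕ} {A : ℕ → ℕ} {G : Digraph (Fin n)}
    (hA : ∀ x y : Fin n, A (x * n + y) = 0 ↔ ¬ G.Adj x y) (hk : k ^ (k * k) ≤ n + 1) (hr : r ≤ k)
    (h : IsFerrersIntersection (G.fillOutside (vertexBlock k b)) r) : BlockTest A n k b r := by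
  classical
  rw [isFerrersIntersection_iff] at h
  obtain ⟨F, hF, hG⟩ := h
  -- Row numbers beyond the matrix, possible in the last blocks, get the empty set, so they never
  -- precede a row with a non-arc.
  let T : Fin r → Fin k → Finset (Fin n) := fun i j =>
    {y | ∃ hx : b * k + j < n, ¬ (F i).Adj ⟨b * k + j, hx⟩ y}
  have hT : ∀ i j j', T i j ⊆ T i j' ∨ T i j' ⊆ T i j := by
    intro i j j'
    by_cases hj : b * k + j < n
    · by_cases hj' : b * k + j' < n
      · rcases (isFerrers_iff_chain _).1 (hF i) ⟨_, hj⟩ ⟨_, hj'⟩ with h | h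
        · right
          intro y
          simpa [T, hj, hj'] using mt (h y)
        · left
          intro y
          simpa [T, hj, hj'] using mt (h y)
      · right
        intro y
        simp [T, hj']
    · left
      intro y
      simp [T, hj]
  choose σ hσ using fun i => exists_perm_antitone_of_chain (T i) (hT i)
  have hpos : ∀ m : Fin (k * k), 0 < k := fun m => Nat.pos_of_ne_zero fun h => by
    have := m.2
    simp [h] at this
  -- Since `r ≤ k`, the `r` lists fit into `k * k` digits; the unused digits are zero.
  obtain ⟨w, hw, hd⟩ := exists_baseDigit_eq (k := k) (m := k * k) fun m =>
    if hi : (m : ℕ) / k < r then σ ⟨m / k, hi⟩ ⟨m % k, Nat.mod_lt _ (hpos m)⟩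
    else ⟨0, hpos m⟩
  have hdig : ∀ (i : Fin r) (l : Fin k), baseDigit k w (i * k + l) = σ i l := by
    intro i l
    have hk0 : 0 < k := l.pos
    have hi : (i : ℕ) + 1 ≤ k := i.2.trans_le hr
    have hlt : (i : ℕ) * k + l < k * k := by
      have := Nat.mul_le_mul_right k hi
      have := l.2
      rw [Nat.succ_mul] at *
      omega
    have h1 : ((i : ℕ) * k + l) / k = i := by
      rw [add_comm, Nat.add_mul_div_right _ _ hk0, Nat.div_eq_of_lt l.2, zero_add]
    have h2 : ((i : ℕ) * k + l) % k = l := by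
      rw [add_comm, Nat.add_mul_mod_self_right, Nat.mod_eq_of_lt l.2]
    rw [hd ⟨_, hlt⟩]
    simp [h1, h2]
  refine ⟨w, by omega, fun y hy j hj hz => ?_⟩
  obtain ⟨hx, hz⟩ := hz
  have hmem : ∀ j < k, b * k + j ∈ vertexBlock k b := fun j hj => ⟨by omega, by omega⟩
  have hnot : ¬ (G.fillOutside (vertexBlock k b)).Adj ⟨b * k + j, hx⟩ ⟨y, hy⟩ := fun h =>
    (hA ⟨b * k + j, hx⟩ ⟨y, hy⟩).1 hz (h (hmem j hj))
  rw [hG] at hnot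
  push Not at hnot
  obtain ⟨i, hi⟩ := hnot
  let l := (σ i).symm ⟨j, hj⟩
  refine ⟨i, i.2, l, l.2, by rw [hdig i l]; simp [l], fun l' hl' => ?_⟩
  have hl'k : l' < k := by have := l.2; omega
  have hsub := hσ i ⟨l', hl'k⟩ l (Fin.le_def.2 (by simpa using Nat.lt_succ_iff.1 hl'))
  have hy' : (⟨y, hy⟩ : Fin n) ∈ T i (σ i l) := by
    simp only [T, l, Equiv.apply_symm_apply, Finset.mem_filter_univ]
    exact ⟨hx, hi⟩
  have hy'' := hsub hy'
  simp only [T, Finset.mem_filter_univ] at hy''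
  obtain ⟨hx', hF'⟩ := hy''
  rw [hdig i ⟨l', hl'k⟩]
  refine ⟨hx', (hA ⟨_, hx'⟩ ⟨y, hy⟩).2 fun hadj => hF' ?_⟩
  exact (hG _ _).1 (fun _ => hadj) i

open Classical in
/-- The number of `r < k` for which the test of block `b` fails. -/
noncomputable def blockDim (A : ℕ → ℕ) (n k b : ℕ) : ℕ :=
  ∑ r ∈ Finset.range k, if BlockTest A n k b r then 0 else 1

/-- One digraph for each row of the block suffices, with all other rows filled. -/
theorem ferrersDim_fillOutside_vertexBlock_le {n : ℕ} (G : Digraph (Fin n)) (k b : ℕ) :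
    ferrersDim (G.fillOutside (vertexBlock k b)) ≤ k := by
  rw [ferrersDim_le_iff, isFerrersIntersection_iff]
  refine ⟨fun i => G.fillOutside {b * k + i}, fun i => ?_, fun x y => ?_⟩
  · rw [isFerrers_iff_chain]
    intro x y
    by_cases hx : (x : ℕ) = b * k + i
    · by_cases hy : (y : ℕ) = b * k + i
      · obtain rfl : x = y := Fin.ext (hx.trans hy.symm)
        exact .inl fun _ => id
      · exact .inl fun z _ h => absurd h hy
    · exact .inr fun z _ h => absurd h hx
  · constructor
    · rintro h i hx
      have hx' : (x : ℕ) = b * k + i := hx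
      exact h ⟨by omega, by omega⟩
    · rintro h ⟨hx1, hx2⟩
      exact h ⟨x - b * k, by omega⟩ (show (x : ℕ) = b * k + (x - b * k) by omega)

/-- The test fails exactly for `r` below the dimension, and the dimension is at most `k`, so
counting the failures below `k` gives it. -/
theorem blockDim_eq_ferrersDim {n k b : ℕ} {A : ℕ → ℕ} {G : Digraph (Fin n)}
    (hA : ∀ x y : Fin n, A (x * n + y) = 0 ↔ ¬ G.Adj x y) (hk : k ^ (k * k) ≤ n + 1) :
    blockDim A n k b = ferrersDim (G.fillOutside (vertexBlock k b)) := by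
  classical
  have htest : ∀ r ∈ Finset.range k, (if BlockTest A n k b r then 0 else 1) =
      if r < ferrersDim (G.fillOutside (vertexBlock k b)) then 1 else 0 := by
    intro r hr
    have : BlockTest A n k b r ↔ ¬ r < ferrersDim (G.fillOutside (vertexBlock k b)) := by
      rw [not_lt, ferrersDim_le_iff]
      exact ⟨fun h => h.isFerrersIntersection hA, fun h =>
        h.blockTest hA hk (Finset.mem_range.1 hr).le⟩
    simp only [this, ite_not]
  have hle := ferrersDim_fillOutside_vertexBlock_le G k b
  rw [blockDim, Finset.sum_congr rfl htest, ← Finset.card_filter]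
  generalize ferrersDim _ = d at *
  rw [show (Finset.range k).filter (· < d) = Finset.range d by ext; simp; omega,
    Finset.card_range]

/-! ### The block size and the approximation factor -/

/-- The number of rows of a block for digraphs on `n` vertices. -/
def blockSize (n : ℕ) : ℕ := Nat.findGreatest (fun k => k ^ (k * k) ≤ n) n

/-- The bound is `n + 1` because of `n = 0`, where the block size is 0 and `0 ^ 0 = 1`. -/
theorem blockSize_pow_le (n : ℕ) : blockSize n ^ (blockSize n * blockSize n) ≤ n + 1 := by
  rcases Nat.eq_zero_or_pos (blockSize n) with h | h
  · simp [h]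
  · exact (Nat.findGreatest_of_ne_zero (P := fun k => k ^ (k * k) ≤ n) rfl h.ne').trans n.le_succ

/-- The approximation of the Ferrers dimension by the sum of the dimensions of the blocks. -/
noncomputable def approxDim (A : ℕ → ℕ) (n : ℕ) : ℕ :=
  ∑ b ∈ Finset.range (n / blockSize n + 1), blockDim A n (blockSize n) b

theorem ferrersDim_le_approxDim {n : ℕ} {A : ℕ → ℕ} {G : Digraph (Fin n)}
    (hA : ∀ x y : Fin n, A (x * n + y) = 0 ↔ ¬ G.Adj x y) : ferrersDim G ≤ approxDim A n := by
  have hn : n ≤ (n / blockSize n + 1) * blockSize n := by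
    rcases Nat.eq_zero_or_pos n with rfl | h
    · exact Nat.zero_le _
    · have h1 : 1 ≤ blockSize n := Nat.le_findGreatest h (by simpa using Nat.succ_le_of_lt h)
      rw [Nat.succ_mul]
      exact (Nat.lt_div_mul_add h1).le
  refine (ferrersDim_le_sum_blocks G hn).trans_eq (Finset.sum_congr rfl fun b _ => ?_)
  rw [blockDim_eq_ferrersDim hA (blockSize_pow_le n)]

theorem approxDim_le {n : ℕ} {A : ℕ → ℕ} {G : Digraph (Fin n)}
    (hA : ∀ x y : Fin n, A (x * n + y) = 0 ↔ ¬ G.Adj x y) :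
    approxDim A n ≤ (n / blockSize n + 1) * ferrersDim G := by
  refine (Finset.sum_le_card_nsmul _ _ (ferrersDim G) fun b _ => ?_).trans_eq (by simp)
  rw [blockDim_eq_ferrersDim hA (blockSize_pow_le n)]
  exact ferrersDim_fillOutside_le _ _

/-- The factor by which the approximation can exceed the Ferrers dimension. -/
noncomputable def approxFactor (n : ℕ) : ℝ := ((n / blockSize n + 1 : ℕ) : ℝ)

/-- With `K` the floor, `K * K ≤ log n / log log n` and `K ≤ log n`, so the logarithm of `K ^ (K *
K)` is `K * K * log K ≤ log n`. -/
theorem floor_sqrt_le_blockSize {n : ℕ} (h1 : 1 ≤ Real.log (Real.log n)) :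
    ⌊√(Real.log n / Real.log (Real.log n))⌋₊ ≤ blockSize n := by
  have hlog : 1 ≤ Real.log n := by
    by_contra! h
    rcases le_or_gt 0 (Real.log n) with h0 | h0
    · linarith [Real.log_nonpos h0 h.le]
    · exact absurd h0 (Real.log_natCast_nonneg n).not_gt
  have hn : (0 : ℝ) < n := by
    rcases Nat.eq_zero_or_pos n with rfl | h
    · norm_num at hlog
    · exact_mod_cast h
  set K := ⌊√(Real.log n / Real.log (Real.log n))⌋₊ with hK
  have hKle : (K : ℝ) ≤ √(Real.log n / Real.log (Real.log n)) := Nat.floor_le (Real.sqrt_nonneg _)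
  have hKsq : (K : ℝ) * K ≤ Real.log n / Real.log (Real.log n) := by
    rw [← Real.mul_self_sqrt (show 0 ≤ Real.log n / Real.log (Real.log n) by positivity)]
    exact mul_self_le_mul_self (Nat.cast_nonneg _) hKle
  have hKsq' : (K : ℝ) * K ≤ Real.log n := hKsq.trans (div_le_self (by linarith) h1)
  rcases Nat.eq_zero_or_pos K with h0 | hpos
  · omega
  have hpos' : (1 : ℝ) ≤ K := by exact_mod_cast hpos
  have hlogK : Real.log K ≤ Real.log (Real.log n) :=
    Real.log_le_log (by linarith) (by nlinarith)
  refine Nat.le_findGreatest ?_ ?_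
  · have : (K : ℝ) ≤ n := by nlinarith [Real.log_le_sub_one_of_pos hn]
    exact_mod_cast this
  · have : Real.log ((K : ℝ) ^ (K * K)) ≤ Real.log n := by
      rw [Real.log_pow]
      push_cast
      calc (K : ℝ) * K * Real.log K
          ≤ Real.log n / Real.log (Real.log n) * Real.log (Real.log n) :=
            mul_le_mul hKsq hlogK (Real.log_nonneg hpos') (by positivity)
        _ = Real.log n := div_mul_cancel₀ _ (by linarith)
    rw [Real.log_le_log_iff (by positivity) hn] at this
    exact_mod_cast this

theorem approxFactor_isBigO :
    approxFactor =O[atTop] (fun n : ℕ =>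
      (n : ℝ) * Real.sqrt (Real.log (Real.log n)) / Real.sqrt (Real.log n)) := by
  -- One factor 2 is lost to the floor, another to the extra block.
  refine IsBigO.of_bound 4 ?_
  have hlim : Tendsto (fun n : ℕ => Real.log (Real.log n)) atTop atTop :=
    Real.tendsto_log_atTop.comp (Real.tendsto_log_atTop.comp tendsto_natCast_atTop_atTop)
  have hlim' : Tendsto (fun n : ℕ => Real.log n) atTop atTop :=
    Real.tendsto_log_atTop.comp tendsto_natCast_atTop_atTop
  filter_upwards [hlim.eventually_ge_atTop 1, hlim'.eventually_ge_atTop 1] with n h1 h2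
  have hK := floor_sqrt_le_blockSize h1
  have hratio : 1 ≤ √(Real.log n / Real.log (Real.log n)) := by
    rw [Real.one_le_sqrt, one_le_div (by linarith)]
    linarith [Real.log_le_sub_one_of_pos (show 0 < Real.log n by linarith)]
  set q := √(Real.log n / Real.log (Real.log n)) with hq
  have hfl : q < (⌊q⌋₊ : ℝ) + 1 := Nat.lt_floor_add_one q
  have hfl1 : (1 : ℝ) ≤ ⌊q⌋₊ := by exact_mod_cast Nat.le_floor (by simpa using hratio)
  have hb : (⌊q⌋₊ : ℝ) ≤ blockSize n := by exact_mod_cast hK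
  have hbn : (blockSize n : ℝ) ≤ n := by exact_mod_cast Nat.findGreatest_le n
  have hqb : q / 2 ≤ blockSize n := by linarith
  have hrhs : (n : ℝ) * √(Real.log (Real.log n)) / √(Real.log n) = n / q := by
    rw [hq, Real.sqrt_div (by linarith), div_div_eq_mul_div]
  rw [hrhs, approxFactor, Real.norm_of_nonneg (Nat.cast_nonneg _),
    Real.norm_of_nonneg (by positivity)]
  have hb0 : (0 : ℝ) < blockSize n := by linarith
  calc ((n / blockSize n + 1 : ℕ) : ℝ) ≤ (n : ℝ) / blockSize n + 1 := by
        push_cast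
        linarith [Nat.cast_div_le (α := ℝ) (m := n) (n := blockSize n)]
    _ ≤ n / blockSize n + n / blockSize n := by
        linarith [(one_le_div hb0).2 hbn]
    _ ≤ n / (q / 2) + n / (q / 2) := by gcongr
    _ = 4 * (n / q) := by field_simp; ring

/-! ### The algorithm runs in polynomial time -/

namespace Ram

open Context

section Algorithm

variable {α : Type*} [Context α] {n k b w i j y x m r : α → ℕ}

theorem PolytimePred.isZeroEntry (hn : Polytime n) (hx : Polytime x) (hy : Polytime y) :
    PolytimePred (fun a => IsZeroEntry (cell a) (n a) (x a) (y a)) :=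
  (PolytimePred.lt hx hn).and (.eq_zero (((hx.mul hn).add hy).cell))

theorem Polytime.baseDigit (hk : Polytime k) (hw : Polytime w) (hm : Polytime m) :
    Polytime (fun a => _root_.baseDigit (k a) (w a) (m a)) :=
  (hw.div_pow hk hm).mod hk

theorem PolytimePred.excludesRow (hn : Polytime n) (hk : Polytime k) (hb : Polytime b)
    (hw : Polytime w) (hi : Polytime i) (hj : Polytime j) (hy : Polytime y) :
    PolytimePred (fun a => ExcludesRow (cell a) (n a) (k a) (b a) (w a) (i a) (j a) (y a)) := by
  refine .exists_lt hk (.and (.eq (.baseDigit hk.comp_fst hw.comp_fst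
    ((hi.mul hk).comp_fst.add .snd)) hj.comp_fst) (.forall_lt (.add .snd (.const 1)) ?_))
  exact .isZeroEntry hn.comp_fst.comp_fst (((hb.mul hk).comp_fst.comp_fst).add
    (.baseDigit hk.comp_fst.comp_fst hw.comp_fst.comp_fst ((hi.mul hk).comp_fst.comp_fst.add .snd)))
    hy.comp_fst.comp_fst

/-- All quantifiers of the test, also the one over the codes `w ≤ n`, have polynomially bounded
range. -/
theorem PolytimePred.blockTest (hn : Polytime n) (hk : Polytime k) (hb : Polytime b)
    (hr : Polytime r) : PolytimePred (fun a => BlockTest (cell a) (n a) (k a) (b a) (r a)) := by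
  refine .exists_lt (hn.add (.const 1)) (.forall_lt hn.comp_fst (.forall_lt hk.comp_fst.comp_fst
    (.imp ?_ (.exists_lt hr.comp_fst.comp_fst.comp_fst ?_))))
  · exact .isZeroEntry hn.comp_fst.comp_fst.comp_fst
      (.add (hb.mul hk).comp_fst.comp_fst.comp_fst .snd) .fst_snd
  · exact .excludesRow hn.comp_fst.comp_fst.comp_fst.comp_fst
      hk.comp_fst.comp_fst.comp_fst.comp_fst hb.comp_fst.comp_fst.comp_fst.comp_fst
      Polytime.fst_snd.comp_fst.comp_fst .snd .fst_snd Polytime.fst_snd.comp_fst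

theorem Polytime.blockDim (hn : Polytime n) (hk : Polytime k) (hb : Polytime b) :
    Polytime (fun a => _root_.blockDim (Context.cell a) (n a) (k a) (b a)) := by
  classical
  exact .sum hk (.ite (.blockTest hn.comp_fst hk.comp_fst hb.comp_fst .snd) (.const 0) (.const 1))

theorem Polytime.blockSize (hn : Polytime n) : Polytime (fun a => _root_.blockSize (n a)) := by
  have hs : Polytime (fun x : α × ℕ => x.2 + 1) := .add .snd (.const 1)
  -- The condition `k ^ (k * k) ≤ n` is tested as `n / k ^ (k * k) ≠ 0`, which avoids computing the
  -- power.
  refine .findGreatest hn ((PolytimePred.eq_zero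
    (hn.comp_fst.div_pow hs (hs.mul hs))).not.of_iff fun x => ?_)
  rw [Nat.div_eq_zero_iff]
  have : 0 < (x.2 + 1) ^ ((x.2 + 1) * (x.2 + 1)) := by positivity
  omega

theorem Polytime.approxDim (hn : Polytime n) : Polytime (fun a => _root_.approxDim (Context.cell a) (n a)) :=
  .sum ((hn.div hn.blockSize).add (.const 1))
    (.blockDim hn.comp_fst hn.blockSize.comp_fst .snd)

end Algorithm

/-- The context of an input digraph: the variables hold the number of vertices, the array the
adjacency matrix. -/
noncomputable instance : Context (Σ n, Digraph (Fin n)) where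
  var a _ := a.1
  cell a := (input a.2).arr 0
  size a := a.1
  var_le _ _ := le_rfl
  cell_le a i := by
    simp only [input]
    split_ifs <;> simp

/-- The adjacency matrix on the input, entry by entry. -/
theorem input_arr_eq_zero_iff {n : ℕ} (G : Digraph (Fin n)) (x y : Fin n) :
    (input G).arr 0 (x * n + y) = 0 ↔ ¬ G.Adj x y := by
  have h : (∃ i j : Fin n, (x : ℕ) * n + y = (i : ℕ) * n + j ∧ G.Adj i j) ↔ G.Adj x y := by
    refine ⟨?_, fun h => ⟨x, y, rfl, h⟩⟩
    rintro ⟨i, j, hij, h⟩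
    have hn : 0 < n := x.pos
    have hx := congrArg (· / n) hij
    have hy := congrArg (· % n) hij
    simp only [add_comm _ (x : ℕ), add_comm (_ * n), Nat.add_mul_div_right _ _ hn,
      Nat.add_mul_mod_self_right, Nat.div_eq_of_lt y.2,
      Nat.div_eq_of_lt j.2, Nat.mod_eq_of_lt y.2, Nat.mod_eq_of_lt j.2, zero_add] at hx hy
    rwa [Fin.ext hx, Fin.ext hy]
  simp [input, h]

/-- A polynomial time function of the context of an input digraph is the output of a program. -/
theorem Polytime.exists_outputs {f : (Σ n, Digraph (Fin n)) → ℕ} (hf : Polytime f) :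
    ∃ (p : Program) (T : Polynomial ℕ), ∀ (n : ℕ) (G : Digraph (Fin n)),
      Outputs p G (T.eval n) (f ⟨n, G⟩) := by
  obtain ⟨-, T, ⟨e, hT⟩, h⟩ := hf
  -- All variables are placed in register 0, which holds `n`; with `M = 1` the result lands in the
  -- output register 1.
  obtain ⟨p, hp⟩ := h 1 (fun _ => 0) fun _ => Nat.zero_lt_one
  refine ⟨p, (.X + .C 2) ^ e, fun n G => ?_⟩
  obtain ⟨t, s, hr, ht, -, -, hs⟩ := hp (input G) ⟨n, G⟩ (fun _ => rfl) rfl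
  exact ⟨t, s, hr, (ht.trans (hT _)).trans_eq (by simp [Context.size]), hs⟩

end Ram

theorem mainTheorem8 :
    ∃ (p : Ram.Program) (ρ : ℕ → ℝ),
      ρ =O[atTop] (fun n : ℕ =>
        (n : ℝ) * Real.sqrt (Real.log (Real.log n)) / Real.sqrt (Real.log n)) ∧
      Ram.IsPolyTimeApprox p ferrersDim ρ := by
  obtain ⟨p, T, h⟩ := (Ram.Polytime.approxDim
    (Ram.Polytime.var (α := Σ n, Digraph (Fin n)) 0)).exists_outputs
  refine ⟨p, approxFactor, approxFactor_isBigO, T, fun n G => ⟨_, h n G, ?_, ?_⟩⟩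
  · exact ferrersDim_le_approxDim (Ram.input_arr_eq_zero_iff G)
  · have := approxDim_le (Ram.input_arr_eq_zero_iff G)
    rw [approxFactor]
    exact_mod_cast this
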